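/- Let $P\subset\mathbb{R}^3$ be an integer polytope, i.e. the convex hull of finitely many points of $\mathbb{Z}^3$, and suppose that $P$ is centrally symmetric, i.e. there is a point $c\in\mathbb{R}^3$ such that $x\mapsto 2c-x$ maps $P$ onto itself. Let $U$ be a random point uniformly distributed in the unit cube $[0,1]^3$, and for a bounded set $C\subset\mathbb{R}^3$ let $$X_C=\bigl|(C+U)\cap\mathbb{Z}^3\bigr|$$ be the number of integer points in the randomly translated set $C+U$. Then for every positive integer $n$, with $nP=\{nx : x\in P\}$, the random variables $X_P$ and $X_{nP}$ (defined with the same $U$) are square-integrable, and $$X_{nP}-\mathbb{E}X_{nP}=nX_P-\mathbb{E}[nX_P]\quad\text{almost surely},$$ that is, $X_{nP}-nX_P$ is almost surely constant; moreover $$\operatorname{Var}X_{nP}=n^2\operatorname{Var}X_P .$$ -/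

import Mathlib

open MeasureTheory ProbabilityTheory
open scoped Pointwise

noncomputable section

/-- The integer points of `ℝ^d`, i.e. the lattice `ℤ^d` as a subset of `ℝ^d`. -/
def integerPoints (d : ℕ) : Set (Fin d → ℝ) :=
  Set.range fun (z : Fin d → ℤ) (i : Fin d) => (z i : ℝ)

/-- An integer (convex) polytope: the convex hull of finitely many integer points. Equivalently, a
convex polytope all of whose vertices are integer points. It may be lower-dimensional. -/
def IsIntegerPolytope {d : ℕ} (P : Set (Fin d → ℝ)) : Prop :=
  ∃ S : Set (Fin d → ℝ), S.Finite ∧ S ⊆ integerPoints d ∧ P = convexHull ℝ S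

/-- `P` is centrally symmetric: it is mapped onto itself by the reflection `x ↦ 2c - x` in some
point `c`, which need be neither the origin nor an integer point. -/
def IsCentrallySymmetric {d : ℕ} (P : Set (Fin d → ℝ)) : Prop :=
  ∃ c : Fin d → ℝ, (fun x => (2 : ℝ) • c - x) '' P = P

/-- The number `|(C + x) ∩ ℤ^d|` of integer points in the translate of `C` by `x`, as a real number
(for bounded `C` the set is finite). -/
def latticeCount {d : ℕ} (C : Set (Fin d → ℝ)) (x : Fin d → ℝ) : ℝ :=
  ((((fun y => y + x) '' C) ∩ integerPoints d).ncard : ℝ)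

/-- The random variable `X_C = |(C + U) ∩ ℤ^d|` for a random translation vector `U`. -/
def shiftCount {Ω : Type*} {d : ℕ} (U : Ω → Fin d → ℝ) (C : Set (Fin d → ℝ)) : Ω → ℝ :=
  fun ω => latticeCount C (U ω)

/-- Equality up to an additive constant: `X - 𝔼 X = Y - 𝔼 Y` almost surely, for
integrable `X` and `Y`. -/
def EqUpToConst {Ω : Type*} [MeasurableSpace Ω] (μ : Measure Ω) (X Y : Ω → ℝ) : Prop :=
  Integrable X μ ∧ Integrable Y μ ∧ ∀ᵐ ω ∂μ, X ω - ∫ ω', X ω' ∂μ = Y ω - ∫ ω', Y ω' ∂μ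

end

/-! Write `N_C(u)` for the number of integer points of `C + u`. The doubled centre of `P` is the sum
of two opposite vertices, hence an integer point, so `N_P(u) = N_P(-u)`, and likewise for `nP`. It
therefore suffices to show that `N_C(u) + N_C(-u)` is, up to a constant, multiplied by `n` when `C`
is dilated by `n`. Here `C` may be any integer polytope, symmetric or not
(`IsIntegerPolytope.exists_translateCount`).

This symmetrized count is additive over a triangulation for almost every `u`, so `C` may be taken to
be an integer simplex. Its edges at one vertex generate a sublattice of `ℤ³`. In edge coordinates
each coset becomes a translate of `ℤ³` and the simplex becomes the standard one, where the count is
explicit. For generic `y` there is `k ∈ {1, 2, 3}` such that the translate by `y` and its reflection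
contribute `C(n+3-k, 3) + C(n+k-1, 3)`. This equals `2 C(n+1, 3)`, plus `n` when `k ≠ 2`. Only the
second term depends on `y`, and it is linear in `n` (`tsum_dilatedStdSimplex_add_neg`).

The law of `U` is absolutely continuous, so the identity for almost every `u` transfers to `U`, and
the variance formula follows. -/

open scoped ENNReal

/-! ### Regular triangulations of a finite point set, up to null sets. -/

section Triangulation

variable {V : Type*} [NormedAddCommGroup V] [NormedSpace ℝ V]

/-- `σ` is the vertex set of a full-dimensional simplex. -/
structure IsSimplexVertexSet (σ : Finset V) : Prop where
  indep : AffineIndependent ℝ ((↑) : σ → V)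
  span : affineSpan ℝ (σ : Set V) = ⊤

namespace IsSimplexVertexSet

variable {σ : Finset V}

/-- The affine basis formed by the vertices of a full-dimensional simplex. -/
noncomputable def basis (h : IsSimplexVertexSet σ) : AffineBasis σ ℝ V :=
  ⟨(↑), h.indep, by simpa using h.span⟩

open Classical in
/-- The barycentric coordinate attached to the vertex `i`. -/
noncomputable def coord (h : IsSimplexVertexSet σ) (i : V) : V →ᵃ[ℝ] ℝ :=
  if hi : i ∈ σ then h.basis.coord ⟨i, hi⟩ else 0

theorem coord_coe (h : IsSimplexVertexSet σ) (i : σ) : h.coord i = h.basis.coord i := by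
  simp [coord]

theorem sum_coord (h : IsSimplexVertexSet σ) (x : V) : ∑ i ∈ σ, h.coord i x = 1 := by
  rw [← Finset.sum_coe_sort]
  simpa only [coord_coe] using h.basis.sum_coord_apply_eq_one x

theorem sum_coord_smul (h : IsSimplexVertexSet σ) (x : V) : ∑ i ∈ σ, h.coord i x • i = x := by
  rw [← Finset.sum_coe_sort]
  simp only [coord_coe]
  exact h.basis.linear_combination_coord_eq_self x

theorem mem_convexHull_iff (h : IsSimplexVertexSet σ) {x : V} :
    x ∈ convexHull ℝ (σ : Set V) ↔ ∀ i ∈ σ, 0 ≤ h.coord i x := by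
  have : (σ : Set V) = Set.range h.basis := by
    show (σ : Set V) = Set.range ((↑) : σ → V)
    simp
  rw [this, h.basis.convexHull_eq_nonneg_coord]
  constructor
  · intro hx i hi
    simpa only [coord_coe] using (show 0 ≤ h.coord ((⟨i, hi⟩ : σ) : V) x from by
      rw [coord_coe]; exact hx ⟨i, hi⟩)
  · intro hx i
    rw [← coord_coe]
    exact hx i i.2

/-- The affine function taking the values `w` at the vertices. -/
noncomputable def interp (h : IsSimplexVertexSet σ) (w : V → ℝ) : V →ᵃ[ℝ] ℝ :=
  ∑ i ∈ σ, w i • h.coord i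

theorem interp_apply (h : IsSimplexVertexSet σ) (w : V → ℝ) (x : V) :
    h.interp w x = ∑ i ∈ σ, h.coord i x * w i := by
  have : ∀ s : Finset V, (∑ i ∈ s, w i • h.coord i) x = ∑ i ∈ s, h.coord i x * w i := by
    classical
    intro s
    induction s using Finset.induction_on with
    | empty => simp
    | insert a s ha ih => rw [Finset.sum_insert ha, Finset.sum_insert ha, ← ih]; simp [mul_comm]
  exact this σ

theorem interp_of_mem (h : IsSimplexVertexSet σ) (w : V → ℝ) {v : V} (hv : v ∈ σ) :
    h.interp w v = w v := by
  classical
  rw [interp_apply, Finset.sum_eq_single_of_mem v hv]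
  · have := h.basis.coord_apply_eq ⟨v, hv⟩
    rw [← coord_coe] at this
    rw [show h.coord v v = 1 from this, one_mul]
  · intro i hi hne
    have := h.basis.coord_apply_ne (i := ⟨i, hi⟩) (j := ⟨v, hv⟩) (by simpa using hne)
    rw [← coord_coe] at this
    rw [show h.coord i v = 0 from this, zero_mul]

theorem card_eq [FiniteDimensional ℝ V] (h : IsSimplexVertexSet σ) :
    σ.card = Module.finrank ℝ V + 1 := by
  have := h.indep.affineSpan_eq_top_iff_card_eq_finrank_add_one.1 (by simpa using h.span)
  simpa using this

end IsSimplexVertexSet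

theorem AffineMap.apply_sum_smul (L : V →ᵃ[ℝ] ℝ) (s : Finset V) (t : V → ℝ)
    (ht : ∑ i ∈ s, t i = 1) : L (∑ i ∈ s, t i • i) = ∑ i ∈ s, t i * L i := by
  have key : ∀ x, L x = L.linear x + L 0 := fun x => by
    have := L.map_vadd 0 x
    simpa using this
  rw [key, map_sum]
  simp only [map_smul, smul_eq_mul]
  calc _ = ∑ i ∈ s, t i * L.linear i + (∑ i ∈ s, t i) * L 0 := by rw [ht, one_mul]
    _ = _ := by
      rw [Finset.sum_mul, ← Finset.sum_add_distrib]
      exact Finset.sum_congr rfl fun i _ => by rw [key i]; ring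

variable [FiniteDimensional ℝ V]

omit [FiniteDimensional ℝ V] in
theorem finrank_lt_card_of_affineSpan_eq_top {σ : Finset V} (h : affineSpan ℝ (σ : Set V) = ⊤) :
    Module.finrank ℝ V + 1 ≤ σ.card := by
  obtain ⟨s, hs, b, hb⟩ := AffineBasis.exists_affine_subbasis h
  have hfin : s.Finite := σ.finite_toSet.subset hs
  have := hfin.fintype
  rw [← b.card_eq_finrank_add_one, ← Set.toFinset_card]
  exact Finset.card_le_card fun x hx => by simpa using hs (by simpa using hx)

omit [FiniteDimensional ℝ V] in
theorem IsSimplexVertexSet.of_card_le {σ : Finset V} (h : affineSpan ℝ (σ : Set V) = ⊤)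
    (hc : σ.card ≤ Module.finrank ℝ V + 1) : IsSimplexVertexSet σ := by
  refine ⟨?_, h⟩
  have hcard : Fintype.card σ = Module.finrank ℝ V + 1 := by
    simpa using le_antisymm hc (finrank_lt_card_of_affineSpan_eq_top h)
  rw [affineIndependent_iff_finrank_vectorSpan_eq ℝ _ hcard]
  have : vectorSpan ℝ (Set.range ((↑) : σ → V)) = ⊤ := by
    rw [← direction_affineSpan]
    simp [h]
  rw [this, finrank_top]

/-- `x` avoids the proper affine subspaces spanned by subsets of `S`. -/
def IsGenericFor (S : Finset V) (x : V) : Prop :=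
  ∀ τ ⊆ S, x ∈ affineSpan ℝ (τ : Set V) → affineSpan ℝ (τ : Set V) = ⊤

theorem ae_isGenericFor [MeasurableSpace V] [BorelSpace V] (μ : Measure V) [μ.IsAddHaarMeasure]
    (S : Finset V) : ∀ᵐ x ∂μ, IsGenericFor S x := by
  classical
  have : ∀ᵐ x ∂μ, ∀ τ ∈ S.powerset, x ∈ affineSpan ℝ (τ : Set V) →
      affineSpan ℝ (τ : Set V) = ⊤ := by
    rw [Finset.eventually_all]
    intro τ _
    by_cases h : affineSpan ℝ (τ : Set V) = ⊤
    · exact Filter.Eventually.of_forall fun _ _ => h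
    · have h0 := Measure.addHaar_affineSubspace μ _ h
      filter_upwards [measure_eq_zero_iff_ae_notMem.1 h0] with x hx hx'
      exact absurd hx' hx
  filter_upwards [this] with x hx τ hτ
  exact hx τ (Finset.mem_powerset.2 hτ)

/-- A vanishing coordinate would put `x` in the hull of a facet, which has too few vertices to span
the space. -/
theorem IsGenericFor.coord_pos {S σ : Finset V} {x : V} (hx : IsGenericFor S x) (hσS : σ ⊆ S)
    (h : IsSimplexVertexSet σ) (hxσ : x ∈ convexHull ℝ (σ : Set V)) {i : V} (hi : i ∈ σ) :
    0 < h.coord i x := by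
  classical
  refine lt_of_le_of_ne (h.mem_convexHull_iff.1 hxσ i hi) fun h0 => ?_
  have hmem : x ∈ convexHull ℝ ((σ.erase i : Finset V) : Set V) := by
    rw [Finset.mem_convexHull']
    refine ⟨fun j => h.coord j x, fun j hj =>
      h.mem_convexHull_iff.1 hxσ j (Finset.mem_of_mem_erase hj), ?_, ?_⟩
    · rw [← h.sum_coord x]
      exact Finset.sum_erase _ h0.symm
    · conv_rhs => rw [← h.sum_coord_smul x]
      exact Finset.sum_erase _ (show h.coord i x • i = 0 by rw [← h0, zero_smul])
  have htop := hx _ ((Finset.erase_subset _ _).trans hσS) (convexHull_subset_affineSpan _ hmem)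
  have h1 := finrank_lt_card_of_affineSpan_eq_top htop
  have h2 := h.card_eq
  rw [Finset.card_erase_of_mem hi] at h1
  omega

/-- The heights `w` are generic: no point of `S` is lifted into the hyperplane through the lifted
vertices of a simplex it does not belong to. -/
def IsGenericHeight (S : Finset V) (w : V → ℝ) : Prop :=
  ∀ σ ⊆ S, ∀ h : IsSimplexVertexSet σ, ∀ v ∈ S, v ∉ σ → h.interp w v ≠ w v

-- Each forbidden coincidence is the kernel of a nonzero functional of `w`, and a real vector space
-- is not a finite union of proper subspaces.
omit [FiniteDimensional ℝ V] in
theorem exists_isGenericHeight (S : Finset V) : ∃ w : V → ℝ, IsGenericHeight S w := by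
  classical
  let ι := {p : S.powerset × S // IsSimplexVertexSet (p.1 : Finset V) ∧ (p.2 : V) ∉ (p.1 : Finset V)}
  let φ : ι → (V → ℝ) →ₗ[ℝ] ℝ := fun p =>
    ∑ i ∈ (p.1.1 : Finset V), p.2.1.coord i p.1.2 • LinearMap.proj i - LinearMap.proj (p.1.2 : V)
  have hφ : ∀ p w, φ p w = p.2.1.interp w p.1.2 - w p.1.2 := fun p w => by
    simp [φ, IsSimplexVertexSet.interp_apply]
  by_contra! hcon
  obtain ⟨p, hp⟩ := Subspace.exists_eq_top_of_iUnion_eq_univ (p := fun p : ι => LinearMap.ker (φ p))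
    (by
      refine Set.eq_univ_of_forall fun w => ?_
      have := hcon w
      simp only [IsGenericHeight] at this
      push Not at this
      obtain ⟨σ, hσ, h, v, hv, hvσ, heq⟩ := this
      refine Set.mem_iUnion.2 ⟨⟨(⟨σ, Finset.mem_powerset.2 hσ⟩, ⟨v, hv⟩), h, hvσ⟩, ?_⟩
      simp [hφ, heq])
  have h0 : φ p (Pi.single (p.1.2 : V) 1) = 0 := by
    rw [← LinearMap.mem_ker, hp]; trivial
  rw [hφ, IsSimplexVertexSet.interp_apply, Finset.sum_eq_zero] at h0
  · simp at h0
  · intro i hi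
    rw [Pi.single_eq_of_ne, mul_zero]
    rintro rfl
    exact p.2.2 hi

/-- A simplex-method pivot: `v` lies below the lifted hyperplane of `σ`, so exchanging it for a
suitable vertex of `σ` keeps `x` in the simplex and lowers the height over `x` by `ε * (h.interp w v
- w v)`. -/
theorem IsGenericFor.exists_interp_lt {S σ : Finset V} {x v : V} {w : V → ℝ}
    (hx : IsGenericFor S x) (hσS : σ ⊆ S) (h : IsSimplexVertexSet σ)
    (hxσ : x ∈ convexHull ℝ (σ : Set V)) (hv : v ∈ S) (hlt : w v < h.interp w v) :
    ∃ τ ⊆ S, ∃ hτ : IsSimplexVertexSet τ, x ∈ convexHull ℝ (τ : Set V) ∧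
      hτ.interp w x < h.interp w x := by
  classical
  have hvσ : v ∉ σ := fun hv' => by rw [h.interp_of_mem w hv'] at hlt; exact lt_irrefl _ hlt
  have hne : (σ.filter fun i => 0 < h.coord i v).Nonempty := by
    by_contra hemp
    rw [Finset.not_nonempty_iff_eq_empty, Finset.filter_eq_empty_iff] at hemp
    have := h.sum_coord v
    have h2 : ∑ i ∈ σ, h.coord i v ≤ 0 := Finset.sum_nonpos fun i hi => not_lt.1 (hemp hi)
    linarith
  -- Ratio test: `ε` is the largest weight that can be put on `v` before some coordinate of `x`
  -- turns negative. The coordinate at `j` is the one that reaches zero, so `j` leaves.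
  obtain ⟨j, hj, hmin⟩ := Finset.exists_min_image _ (fun i => h.coord i x / h.coord i v) hne
  rw [Finset.mem_filter] at hj
  set ε := h.coord j x / h.coord j v with hε
  have hεpos : 0 < ε := div_pos (hx.coord_pos hσS h hxσ hj.1) hj.2
  set t : V → ℝ := fun i => if i = v then ε else h.coord i x - ε * h.coord i v with ht
  have htv : t v = ε := by simp [ht]
  have htne : ∀ i ∈ σ, t i = h.coord i x - ε * h.coord i v := fun i hi => by
    simp only [ht]
    rw [if_neg]
    rintro rfl
    exact hvσ hi
  have htj : t j = 0 := by
    rw [htne j hj.1, hε]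
    field_simp [hj.2.ne']
    ring
  have htnn : ∀ i ∈ σ, 0 ≤ t i := fun i hi => by
    rw [htne i hi]
    have hxi := hx.coord_pos hσS h hxσ hi
    rcases le_or_gt (h.coord i v) 0 with hle | hgt
    · nlinarith
    · have := hmin i (Finset.mem_filter.2 ⟨hi, hgt⟩)
      rw [le_div_iff₀ hgt] at this
      linarith
  have hv' : v ∉ σ.erase j := fun hh => hvσ (Finset.mem_of_mem_erase hh)
  have hsum : ∑ i ∈ insert v (σ.erase j), t i = 1 := by
    rw [Finset.sum_insert hv', Finset.sum_erase _ htj, Finset.sum_congr rfl htne, htv,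
      Finset.sum_sub_distrib, ← Finset.mul_sum, h.sum_coord, h.sum_coord]
    ring
  have hcomb : ∑ i ∈ insert v (σ.erase j), t i • i = x := by
    rw [Finset.sum_insert hv', Finset.sum_erase _ (by rw [htj, zero_smul]),
      Finset.sum_congr rfl fun i hi => by rw [htne i hi], htv]
    simp only [sub_smul, Finset.sum_sub_distrib, mul_smul, ← Finset.smul_sum, h.sum_coord_smul]
    abel
  have hmem : x ∈ convexHull ℝ ((insert v (σ.erase j) : Finset V) : Set V) := by
    rw [Finset.mem_convexHull']
    refine ⟨t, fun i hi => ?_, hsum, hcomb⟩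
    rcases Finset.mem_insert.1 hi with rfl | hi
    · rw [htv]; exact hεpos.le
    · exact htnn i (Finset.mem_of_mem_erase hi)
  have hsub : insert v (σ.erase j) ⊆ S :=
    Finset.insert_subset hv ((Finset.erase_subset _ _).trans hσS)
  have hτ : IsSimplexVertexSet (insert v (σ.erase j)) := by
    refine .of_card_le (hx _ hsub (convexHull_subset_affineSpan _ hmem)) ?_
    rw [← h.card_eq, Finset.card_insert_of_notMem hv', Finset.card_erase_of_mem hj.1]
    have := Finset.card_pos.2 ⟨j, hj.1⟩
    omega
  refine ⟨_, hsub, hτ, hmem, ?_⟩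
  have e1 : hτ.interp w x = ∑ i ∈ insert v (σ.erase j), t i * w i := by
    conv_lhs => rw [← hcomb]
    rw [AffineMap.apply_sum_smul _ _ _ hsum]
    exact Finset.sum_congr rfl fun i hi => by rw [hτ.interp_of_mem w hi]
  rw [e1, Finset.sum_insert hv', Finset.sum_erase _ (by rw [htj, zero_mul]),
    Finset.sum_congr rfl fun i hi => by rw [htne i hi], htv]
  simp only [sub_mul, Finset.sum_sub_distrib, mul_assoc, ← Finset.mul_sum]
  rw [← h.interp_apply, ← h.interp_apply]
  nlinarith

/-- Regular triangulation: up to a null set, the convex hull of a finite set is the disjoint union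
of finitely many full-dimensional simplices with vertices in that set. -/
theorem exists_triangulation [MeasurableSpace V] [BorelSpace V] (μ : Measure V)
    [μ.IsAddHaarMeasure] (S : Finset V) :
    ∃ T : Finset (Finset V), (∀ σ ∈ T, σ ⊆ S ∧ IsSimplexVertexSet σ) ∧
      ∀ᵐ x ∂μ, (convexHull ℝ (S : Set V)).indicator (1 : V → ENNReal) x =
        ∑ σ ∈ T, (convexHull ℝ (σ : Set V)).indicator 1 x := by
  classical
  obtain ⟨w, hw⟩ := exists_isGenericHeight S
  -- The simplices of `T` are the projected lower faces of the lifted points.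
  refine ⟨S.powerset.filter fun σ => ∃ h : IsSimplexVertexSet σ, ∀ v ∈ S, h.interp w v ≤ w v,
    fun σ hσ => ?_, ?_⟩
  · rw [Finset.mem_filter, Finset.mem_powerset] at hσ
    exact ⟨hσ.1, hσ.2.1⟩
  filter_upwards [ae_isGenericFor μ S] with x hx
  by_cases hxS : x ∈ convexHull ℝ (S : Set V)
  -- Existence: by Carathéodory some simplex contains `x`. One of least height over `x` is a lower
  -- face, since otherwise a pivot would improve it.
  · let F := S.powerset.filter fun σ => IsSimplexVertexSet σ ∧ x ∈ convexHull ℝ (σ : Set V)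
    have hF : F.Nonempty := by
      have h1 := hxS
      rw [convexHull_eq_union] at h1
      simp only [Set.mem_iUnion] at h1
      obtain ⟨t, htS, hti, hxt⟩ := h1
      have htS' : t ⊆ S := by exact_mod_cast htS
      exact ⟨t, Finset.mem_filter.2 ⟨Finset.mem_powerset.2 htS', ⟨hti,
        hx t htS' (convexHull_subset_affineSpan _ hxt)⟩, hxt⟩⟩
    obtain ⟨σ, hσF, hmin⟩ := Finset.exists_min_image F
      (fun σ => if h : IsSimplexVertexSet σ then h.interp w x else 0) hF
    rw [Finset.mem_filter, Finset.mem_powerset] at hσF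
    obtain ⟨hσS, hσ, hxσ⟩ := hσF
    have hlow : ∀ v ∈ S, hσ.interp w v ≤ w v := by
      intro v hv
      by_contra! hlt
      obtain ⟨τ, hτS, hτ, hxτ, hτlt⟩ := hx.exists_interp_lt hσS hσ hxσ hv hlt
      have := hmin τ (Finset.mem_filter.2 ⟨Finset.mem_powerset.2 hτS, hτ, hxτ⟩)
      rw [dif_pos hτ, dif_pos hσ] at this
      linarith
    rw [Set.indicator_of_mem hxS, Finset.sum_eq_single_of_mem σ, Set.indicator_of_mem hxσ]
    · exact Finset.mem_filter.2 ⟨Finset.mem_powerset.2 hσS, hσ, hlow⟩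
    -- Uniqueness: two lower faces containing `x` bound each other's height there. A vertex of `τ`
    -- outside `σ` would make one of these bounds strict.
    · intro τ hτT hne
      rw [Finset.mem_filter, Finset.mem_powerset] at hτT
      obtain ⟨hτS, hτ, hτlow⟩ := hτT
      refine Set.indicator_of_notMem (fun hxτ => hne ?_) _
      have expand : ∀ {σ τ : Finset V} (hσ : IsSimplexVertexSet σ) (hτ : IsSimplexVertexSet τ),
          hσ.interp w x = ∑ i ∈ τ, hτ.coord i x * hσ.interp w i := fun hσ hτ => by
        conv_lhs => rw [← hτ.sum_coord_smul x]
        exact AffineMap.apply_sum_smul _ _ _ (hτ.sum_coord x)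
      have hle1 : hτ.interp w x ≤ hσ.interp w x := by
        rw [expand hτ hσ, hσ.interp_apply]
        exact Finset.sum_le_sum fun i hi =>
          mul_le_mul_of_nonneg_left (hτlow i (hσS hi)) (hx.coord_pos hσS hσ hxσ hi).le
      have hsub : τ ⊆ σ := by
        intro v hv
        by_contra hvσ
        have hlt : hσ.interp w v < w v := lt_of_le_of_ne (hlow v (hτS hv))
          (hw σ hσS hσ v (hτS hv) hvσ)
        have : hσ.interp w x < hτ.interp w x := by
          rw [expand hσ hτ, hτ.interp_apply]
          exact Finset.sum_lt_sum (fun i hi =>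
            mul_le_mul_of_nonneg_left (hlow i (hτS hi)) (hx.coord_pos hτS hτ hxτ hi).le)
            ⟨v, hv, mul_lt_mul_of_pos_left hlt (hx.coord_pos hτS hτ hxτ hv)⟩
        linarith
      exact Finset.eq_of_subset_of_card_le hsub (by rw [hσ.card_eq, hτ.card_eq])
  · rw [Set.indicator_of_notMem hxS, Finset.sum_eq_zero]
    intro σ hσ
    rw [Finset.mem_filter, Finset.mem_powerset] at hσ
    exact Set.indicator_of_notMem (fun hxσ => hxS (convexHull_mono (by exact_mod_cast hσ.1) hxσ)) _

end Triangulation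

/-! ### Lattice points in translates of dilated standard simplices. -/

/-- Stars and bars: `C(N, 3)` counts the points `w ≥ 0` of `ℤ³` with `∑ w ≤ N - 3`. -/
theorem encard_nonneg_sum_add_three_le (N : ℕ) :
    {w : Fin 3 → ℤ | (∀ i, 0 ≤ w i) ∧ ∑ i, w i + 3 ≤ N}.encard = (N.choose 3 : ℕ) := by
  obtain hN | ⟨m, rfl⟩ : N < 3 ∨ ∃ m, N = m + 3 := by
    rcases lt_or_ge N 3 with h | h
    · exact .inl h
    · exact .inr ⟨N - 3, by omega⟩
  · rw [Nat.choose_eq_zero_of_lt hN, Nat.cast_zero, Set.encard_eq_zero,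
      Set.eq_empty_iff_forall_notMem]
    rintro w ⟨h0, h1⟩
    have := Finset.sum_nonneg fun i (_ : i ∈ Finset.univ) => h0 i
    omega
  -- The slack `m - ∑ w` becomes a fourth coordinate.
  · let e : {w : Fin 3 → ℤ | (∀ i, 0 ≤ w i) ∧ ∑ i, w i + 3 ≤ ((m + 3 : ℕ) : ℤ)} ≃
        {f : Fin 4 → ℕ // ∑ i, f i = m} :=
      { toFun := fun w => ⟨Fin.cons (m - ∑ i, (w.1 i).toNat) fun i => (w.1 i).toNat, by
          obtain ⟨w, h0, h1⟩ := w
          have h2 := h0 0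
          have h3 := h0 1
          have h4 := h0 2
          simp [Fin.sum_univ_succ] at h1 h2 h3 h4 ⊢
          omega⟩
        invFun := fun f => ⟨fun i => f.1 i.succ, fun i => by positivity, by
          have := f.2
          simp only [Fin.sum_univ_succ] at *
          simp at *
          omega⟩
        left_inv := by
          rintro ⟨w, h0, h1⟩
          ext i
          simpa using h0 i
        right_inv := by
          rintro ⟨f, hf⟩
          ext i
          refine Fin.cases ?_ (fun i => ?_) i
          · simp [Fin.sum_univ_succ] at hf ⊢
            omega
          · simp }
    have hcard := Nat.card_congr (e.trans (Sym.equivNatSumOfFintype (Fin 4) m).symm)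
    rw [Nat.card_eq_fintype_card (α := Sym (Fin 4) m), Sym.card_sym_eq_choose,
      Fintype.card_fin] at hcard
    have hfin : Finite {w : Fin 3 → ℤ | (∀ i, 0 ≤ w i) ∧ ∑ i, w i + 3 ≤ ((m + 3 : ℕ) : ℤ)} :=
      Finite.of_equiv _ (e.trans (Sym.equivNatSumOfFintype (Fin 4) m).symm).symm
    rw [← Set.Finite.cast_ncard_eq (Set.toFinite _), ← Nat.card_coe_set_eq, hcard]
    congr 1
    rw [show 4 + m - 1 = m + 3 by omega, Nat.choose_symm_add]

/-- The `n`-th dilate of the standard simplex of `ℝ³`. -/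
def dilatedStdSimplex (n : ℕ) : Set (Fin 3 → ℝ) := {x | (∀ i, 0 ≤ x i) ∧ ∑ i, x i ≤ n}

theorem tsum_indicator_comp {α β : Type*} (f : α → β) (C : Set β) :
    ∑' z, C.indicator (1 : β → ℝ≥0∞) (f z) = (f ⁻¹' C).encard := by
  rw [← ENNReal.tsum_set_one, tsum_subtype (f ⁻¹' C) (fun _ => (1 : ℝ≥0∞))]
  rfl

/-- Since `y` lies in the open cube, `y + w ≥ 0` means `w ≥ 0`. Since `k` is the ceiling of the
non-integer `∑ y`, the remaining inequality means `∑ w ≤ n - k`. -/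
theorem tsum_dilatedStdSimplex_of_mem_Ioo {y : Fin 3 → ℝ} (h0 : ∀ i, 0 < y i) (h1 : ∀ i, y i < 1)
    {k n N : ℕ} (hk : ∑ i, y i < k) (hk' : (k : ℝ) < ∑ i, y i + 1) (hN : N + k = n + 3) :
    ∑' w : Fin 3 → ℤ, (dilatedStdSimplex n).indicator (1 : (Fin 3 → ℝ) → ℝ≥0∞) (fun i => y i + w i) =
      N.choose 3 := by
  rw [tsum_indicator_comp]
  have : (fun (w : Fin 3 → ℤ) i => y i + w i) ⁻¹' dilatedStdSimplex n =
      {w : Fin 3 → ℤ | (∀ i, 0 ≤ w i) ∧ ∑ i, w i + 3 ≤ N} := by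
    ext w
    simp only [dilatedStdSimplex, Set.mem_preimage, Set.mem_ofPred_eq]
    refine and_congr (forall_congr' fun i => ?_) ?_
    · constructor
      · intro h
        have : (-1 : ℝ) < w i := by linarith [h1 i]
        have : -1 < w i := by exact_mod_cast this
        omega
      · intro h
        have : (0 : ℝ) ≤ w i := by exact_mod_cast h
        linarith [h0 i]
    · rw [Finset.sum_add_distrib]
      have hcast : (∑ i, (w i : ℝ)) = ((∑ i, w i : ℤ) : ℝ) := by push_cast; rfl
      rw [hcast]
      have hN' : (N : ℤ) + k = n + 3 := by exact_mod_cast hN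
      constructor
      · intro h
        have : (((∑ i, w i) + k : ℤ) : ℝ) < ((n + 1 : ℤ) : ℝ) := by push_cast at *; linarith
        have : (∑ i, w i) + k < (n + 1 : ℤ) := by exact_mod_cast this
        omega
      · intro h
        have : (∑ i, w i) + k ≤ (n : ℤ) := by omega
        have : (((∑ i, w i) + k : ℤ) : ℝ) ≤ ((n : ℤ) : ℝ) := by exact_mod_cast this
        push_cast at *
        linarith
  rw [this, encard_nonneg_sum_add_three_le]
  simp

/-- The second difference of `C(·, 3)` is `C(·, 1)`. This is what makes the symmetrized count linear
in `n`. -/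
theorem choose_three_add_choose_three (n : ℕ) :
    (n + 2).choose 3 + n.choose 3 = n + 2 * (n + 1).choose 3 := by
  have h1 : (n + 2).choose 3 = (n + 1).choose 2 + (n + 1).choose 3 := Nat.choose_succ_succ _ _
  have h2 : (n + 1).choose 3 = n.choose 2 + n.choose 3 := Nat.choose_succ_succ _ _
  have h3 : (n + 1).choose 2 = n.choose 1 + n.choose 2 := Nat.choose_succ_succ _ _
  rw [Nat.choose_one_right] at h3
  omega

theorem tsum_dilatedStdSimplex_translate (n : ℕ) (y : Fin 3 → ℝ) (v : Fin 3 → ℤ) :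
    ∑' w : Fin 3 → ℤ, (dilatedStdSimplex n).indicator (1 : (Fin 3 → ℝ) → ℝ≥0∞)
      (fun i => (y i + v i) + w i) =
    ∑' w : Fin 3 → ℤ, (dilatedStdSimplex n).indicator (1 : (Fin 3 → ℝ) → ℝ≥0∞) (fun i => y i + w i) := by
  rw [← (Equiv.addLeft v).tsum_eq (fun w : Fin 3 → ℤ =>
    (dilatedStdSimplex n).indicator (1 : (Fin 3 → ℝ) → ℝ≥0∞) (fun i => y i + w i))]
  refine tsum_congr fun w => congrArg _ (funext fun i => ?_)
  simp only [Equiv.coe_addLeft, Pi.add_apply]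
  push_cast
  ring

/-- `y` lies on no integer translate of the facet hyperplanes of the standard simplex. -/
def AvoidsFacetPlanes (y : Fin 3 → ℝ) : Prop :=
  (∀ i, ∀ m : ℤ, y i ≠ m) ∧ ∀ m : ℤ, ∑ i, y i ≠ m

/-- Here `k` is the ceiling of the sum `F` of the fractional parts. Reflection turns each fractional
part `f` into `1 - f`, hence `F` into `3 - F` and `k` into `4 - k`. -/
theorem exists_tsum_dilatedStdSimplex {y : Fin 3 → ℝ} (hy : AvoidsFacetPlanes y) :
    ∃ k : ℕ, 1 ≤ k ∧ k ≤ 3 ∧ ∀ n : ℕ,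
      ∑' w : Fin 3 → ℤ, (dilatedStdSimplex n).indicator (1 : (Fin 3 → ℝ) → ℝ≥0∞) (fun i => y i + w i) =
        ((n + 3 - k).choose 3 : ℕ) ∧
      ∑' w : Fin 3 → ℤ, (dilatedStdSimplex n).indicator (1 : (Fin 3 → ℝ) → ℝ≥0∞) (fun i => -y i + w i) =
        ((n + k - 1).choose 3 : ℕ) := by
  have h0 : ∀ i, 0 < Int.fract (y i) := fun i =>
    lt_of_le_of_ne (Int.fract_nonneg _) fun h => hy.1 i ⌊y i⌋ (by
      have := Int.fract_add_floor (y i); linarith)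
  have h1 : ∀ i, Int.fract (y i) < 1 := fun i => Int.fract_lt_one _
  set F := ∑ i, Int.fract (y i) with hF
  have hF0 : 0 < F := Finset.sum_pos (fun i _ => h0 i) Finset.univ_nonempty
  have hF3 : F < 3 := by
    have := Finset.sum_lt_sum_of_nonempty Finset.univ_nonempty fun i _ => h1 i
    simpa using this
  have hFint : ∀ m : ℤ, F ≠ m := fun m hm => hy.2 (m + ∑ i, ⌊y i⌋) (by
    push_cast
    rw [← hm, hF, ← Finset.sum_add_distrib]
    exact Finset.sum_congr rfl fun i _ => (Int.fract_add_floor _).symm)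
  have hk1 : 1 ≤ ⌈F⌉₊ := Nat.one_le_ceil_iff.2 hF0
  have hk3 : ⌈F⌉₊ ≤ 3 := Nat.ceil_le.2 (by exact_mod_cast hF3.le)
  have hlt : F < ⌈F⌉₊ := lt_of_le_of_ne (Nat.le_ceil F) (by simpa using hFint ⌈F⌉₊)
  have hlt' : (⌈F⌉₊ : ℝ) < F + 1 := Nat.ceil_lt_add_one hF0.le
  refine ⟨⌈F⌉₊, hk1, hk3, fun n => ⟨?_, ?_⟩⟩
  · rw [← tsum_dilatedStdSimplex_of_mem_Ioo h0 h1 hlt hlt' (n := n) (by omega),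
      ← tsum_dilatedStdSimplex_translate n (fun i => Int.fract (y i)) fun i => ⌊y i⌋]
    simp only [Int.fract_add_floor]
  · have hs : ∑ i, (1 - Int.fract (y i)) = 3 - F := by
      rw [Finset.sum_sub_distrib]; simp [hF]
    rw [← tsum_dilatedStdSimplex_of_mem_Ioo (y := fun i => 1 - Int.fract (y i)) (k := 4 - ⌈F⌉₊)
        (n := n) (fun i => by linarith [h1 i]) (fun i => by linarith [h0 i])
        (by rw [hs, Nat.cast_sub (by omega)]; push_cast; linarith)
        (by rw [hs, Nat.cast_sub (by omega)]; push_cast; linarith) (by omega),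
      ← tsum_dilatedStdSimplex_translate n (fun i => 1 - Int.fract (y i)) fun i => -⌊y i⌋ - 1]
    refine tsum_congr fun w => congrArg _ (funext fun i => ?_)
    have := Int.fract_add_floor (y i)
    push_cast
    linarith

/-- Up to a constant, the number of integer points in the translates of a dilated standard simplex
and of its reflection grows linearly with the dilation factor. -/
theorem tsum_dilatedStdSimplex_add_neg {y : Fin 3 → ℝ} (hy : AvoidsFacetPlanes y) (n : ℕ) :
    ∑' w : Fin 3 → ℤ, ((dilatedStdSimplex n).indicator (1 : (Fin 3 → ℝ) → ℝ≥0∞) (fun i => y i + w i) +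
        (dilatedStdSimplex n).indicator 1 (fun i => -(y i + w i))) =
      n * ∑' w : Fin 3 → ℤ, ((dilatedStdSimplex 1).indicator (1 : (Fin 3 → ℝ) → ℝ≥0∞) (fun i => y i + w i) +
        (dilatedStdSimplex 1).indicator 1 (fun i => -(y i + w i))) +
      (2 * (n + 1).choose 3 : ℕ) := by
  obtain ⟨k, hk1, hk3, hk⟩ := exists_tsum_dilatedStdSimplex hy
  have hneg : ∀ m : ℕ, ∑' w : Fin 3 → ℤ,
      (dilatedStdSimplex m).indicator (1 : (Fin 3 → ℝ) → ℝ≥0∞) (fun i => -(y i + w i)) =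
      ∑' w : Fin 3 → ℤ, (dilatedStdSimplex m).indicator (1 : (Fin 3 → ℝ) → ℝ≥0∞) (fun i => -y i + w i) := by
    intro m
    rw [← (Equiv.neg (Fin 3 → ℤ)).tsum_eq (fun w : Fin 3 → ℤ =>
      (dilatedStdSimplex m).indicator (1 : (Fin 3 → ℝ) → ℝ≥0∞) (fun i => -y i + w i))]
    refine tsum_congr fun w => congrArg _ (funext fun i => ?_)
    simp only [Equiv.neg_apply, Pi.neg_apply]
    push_cast
    ring
  simp only [ENNReal.tsum_add, hneg, hk]
  norm_cast
  have := choose_three_add_choose_three n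
  have h13 : Nat.choose 1 3 = 0 := rfl
  -- The value at `n = 1` is 1 for `k = 1, 3` and 0 for `k = 2`.
  interval_cases k
  · rw [show n + 3 - 1 = n + 2 by omega, Nat.add_sub_cancel]
    simpa [h13] using this
  · rw [show n + 3 - 2 = n + 1 by omega, show n + 2 - 1 = n + 1 by omega]
    simp
    omega
  · rw [show n + 3 - 3 = n by omega, show n + 3 - 1 = n + 2 by omega]
    simp [h13]
    omega

/-! ### Translate counts, generic translations and coset sums. -/

/-- The inclusion of `ℤ^d` into `ℝ^d`. -/
def intVec {d : ℕ} : (Fin d → ℤ) →+ (Fin d → ℝ) where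
  toFun z i := z i
  map_zero' := by ext; simp
  map_add' _ _ := by ext; simp

@[simp]
theorem intVec_apply {d : ℕ} (z : Fin d → ℤ) (i : Fin d) : intVec z i = z i := rfl

theorem intVec_injective {d : ℕ} : Function.Injective (intVec (d := d)) := fun z w h => by
  ext i
  have := congrFun h i
  simp only [intVec_apply] at this
  exact_mod_cast this

theorem mem_integerPoints_iff {d : ℕ} {x : Fin d → ℝ} :
    x ∈ integerPoints d ↔ ∃ z : Fin d → ℤ, intVec z = x := Iff.rfl

/-- The number of integer points of `C + u`, as an extended nonnegative number. -/
noncomputable def translateCount {d : ℕ} (C : Set (Fin d → ℝ)) (u : Fin d → ℝ) : ℝ≥0∞ :=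
  ∑' z : Fin d → ℤ, C.indicator 1 (intVec z - u)

theorem toReal_translateCount {d : ℕ} (C : Set (Fin d → ℝ)) (u : Fin d → ℝ) :
    (translateCount C u).toReal = latticeCount C u := by
  rw [translateCount, tsum_indicator_comp (fun z : Fin d → ℤ => intVec z - u), latticeCount]
  have : (fun y => y + u) '' C ∩ integerPoints d =
      intVec '' ((fun z : Fin d → ℤ => intVec z - u) ⁻¹' C) := by
    ext x
    constructor
    · rintro ⟨⟨y, hy, rfl⟩, z, hz⟩
      refine ⟨z, ?_, hz⟩
      have : intVec z = y + u := hz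
      simpa [this] using hy
    · rintro ⟨z, hz, rfl⟩
      exact ⟨⟨_, hz, sub_add_cancel _ _⟩, z, rfl⟩
  rw [this, Set.ncard_image_of_injective _ intVec_injective, Set.ncard_def]
  generalize Set.encard _ = k
  cases k <;> simp

theorem translateCount_neg {d : ℕ} (C : Set (Fin d → ℝ)) (u : Fin d → ℝ) :
    translateCount C (-u) = ∑' z : Fin d → ℤ, C.indicator 1 (-(intVec z - u)) := by
  rw [translateCount, ← (Equiv.neg (Fin d → ℤ)).tsum_eq]
  refine tsum_congr fun z => congrArg _ ?_
  simp only [Equiv.neg_apply, map_neg]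
  abel

theorem tsum_indicator_intVec_add {d : ℕ} (f : (Fin d → ℝ) → ℝ≥0∞) (v : Fin d → ℤ) :
    ∑' z : Fin d → ℤ, f (intVec z + intVec v) = ∑' z : Fin d → ℤ, f (intVec z) := by
  rw [← (Equiv.addRight v).tsum_eq (fun z => f (intVec z))]
  simp

theorem ae_linearMap_ne {V : Type*} [NormedAddCommGroup V] [NormedSpace ℝ V]
    [FiniteDimensional ℝ V] [MeasurableSpace V] [BorelSpace V] (μ : Measure V)
    [μ.IsAddHaarMeasure] {l : V →ₗ[ℝ] ℝ} (hl : l ≠ 0) (c : ℝ) : ∀ᵐ u ∂μ, l u ≠ c := by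
  obtain ⟨u₀, hu₀⟩ := LinearMap.surjective hl c
  have hne : AffineSubspace.mk' u₀ (LinearMap.ker l) ≠ ⊤ := fun h => by
    have := congrArg AffineSubspace.direction h
    rw [AffineSubspace.direction_mk', AffineSubspace.direction_top, LinearMap.ker_eq_top] at this
    exact hl this
  filter_upwards [measure_eq_zero_iff_ae_notMem.1 (Measure.addHaar_affineSubspace μ _ hne)]
    with u hu huc
  refine hu ?_
  rw [SetLike.mem_coe, AffineSubspace.mem_mk', vsub_eq_sub, LinearMap.mem_ker, map_sub, huc, hu₀,
    sub_self]

theorem ae_avoidsFacetPlanes (A : (Fin 3 → ℝ) ≃ₗ[ℝ] (Fin 3 → ℝ)) :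
    ∀ᵐ u : Fin 3 → ℝ, ∀ z : Fin 3 → ℤ, AvoidsFacetPlanes (A (intVec z - u)) := by
  have key : ∀ l : (Fin 3 → ℝ) →ₗ[ℝ] ℝ, l ≠ 0 → ∀ z : Fin 3 → ℤ, ∀ m : ℤ,
      ∀ᵐ u : Fin 3 → ℝ, l (A (intVec z - u)) ≠ m := by
    intro l hl z m
    have hlA : l ∘ₗ A.toLinearMap ≠ 0 := fun h => hl <| LinearMap.ext fun y => by
      simpa using LinearMap.congr_fun h (A.symm y)
    filter_upwards [ae_linearMap_ne volume hlA (l (A (intVec z)) - m)] with u hu h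
    refine hu ?_
    simp only [map_sub] at h
    simp only [LinearMap.comp_apply, LinearEquiv.coe_coe]
    linarith
  rw [ae_all_iff]
  intro z
  refine Filter.Eventually.and ?_ ?_
  · rw [ae_all_iff]
    intro i
    rw [ae_all_iff]
    intro m
    refine key (LinearMap.proj i) (fun h => ?_) z m
    simpa using LinearMap.congr_fun h (Pi.single i 1)
  · rw [ae_all_iff]
    intro m
    have := key (∑ i, LinearMap.proj i) (fun h => ?_) z m
    · simpa using this
    · simpa [Fin.sum_univ_succ] using LinearMap.congr_fun h (Pi.single 0 1)

/-- Splitting a sum over `ℤ^d` into the cosets of the image of an injective endomorphism. -/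
theorem tsum_eq_tsum_cosets {G : Type*} [AddCommGroup G] (φ : G →+ G)
    (hφ : Function.Injective φ) (f : G → ℝ≥0∞) :
    ∑' z, f z = ∑' q : G ⧸ φ.range, ∑' w, f (q.out + φ w) := by
  let e : (G ⧸ φ.range) × G ≃ G := Equiv.ofBijective (fun p => p.1.out + φ p.2) (by
    have hmk : ∀ (q : G ⧸ φ.range) w, ((q.out + φ w : G) : G ⧸ φ.range) = q := fun q w => by
      rw [QuotientAddGroup.mk_add, (QuotientAddGroup.eq_zero_iff (N := φ.range) (φ w)).2
        (AddMonoidHom.mem_range.2 ⟨w, rfl⟩), add_zero]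
      exact QuotientAddGroup.out_eq' q
    constructor
    · rintro ⟨q, w⟩ ⟨q', w'⟩ h
      obtain rfl : q = q' := by
        rw [← hmk q w, ← hmk q' w']
        exact congrArg _ h
      exact congrArg (Prod.mk q) (hφ (add_left_cancel h))
    · intro z
      have : ((z : G ⧸ φ.range).out : G ⧸ φ.range) = z := QuotientAddGroup.out_eq' _
      obtain ⟨w, hw⟩ := QuotientAddGroup.eq.1 this
      refine ⟨((z : G ⧸ φ.range), w), ?_⟩
      show (z : G ⧸ φ.range).out + φ w = z
      rw [hw]
      abel)
  rw [← e.tsum_eq]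
  exact ENNReal.tsum_prod (f := fun (q : G ⧸ φ.range) w => f (q.out + φ w))

theorem inv_smul_mem_dilatedStdSimplex {n : ℕ} (hn : 0 < n) (y : Fin 3 → ℝ) :
    (n : ℝ)⁻¹ • y ∈ dilatedStdSimplex 1 ↔ y ∈ dilatedStdSimplex n := by
  have hn' : (0 : ℝ) < n := by exact_mod_cast hn
  simp only [dilatedStdSimplex, Set.mem_ofPred_eq, Pi.smul_apply, smul_eq_mul, ← Finset.mul_sum,
    Nat.cast_one]
  refine and_congr (forall_congr' fun i => ?_) ?_
  · rw [mul_nonneg_iff_of_pos_left (inv_pos.2 hn')]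
  · rw [inv_mul_le_iff₀ hn', mul_one]

/-! ### Reduction of integer simplices to the standard simplex. -/

/-- The linear map taking the edges at the vertex `b 0` to the standard basis. -/
noncomputable def AffineBasis.edgeCoords {d : ℕ} (b : AffineBasis (Fin (d + 1)) ℝ (Fin d → ℝ)) :
    (Fin d → ℝ) ≃ₗ[ℝ] (Fin d → ℝ) :=
  ((b.basisOf 0).reindex (finSuccAboveEquiv 0).symm).equivFun

theorem AffineBasis.edgeCoords_symm_apply {d : ℕ} (b : AffineBasis (Fin (d + 1)) ℝ (Fin d → ℝ))
    (y : Fin d → ℝ) : b.edgeCoords.symm y = ∑ i, y i • (b i.succ - b 0) := by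
  simp only [edgeCoords, Module.Basis.equivFun_symm_apply, Module.Basis.reindex_apply,
    Equiv.symm_symm, basisOf_apply, finSuccAboveEquiv_apply, Fin.succAbove_zero, vsub_eq_sub]

theorem AffineBasis.edgeCoords_sub {d : ℕ} (b : AffineBasis (Fin (d + 1)) ℝ (Fin d → ℝ))
    (x : Fin d → ℝ) : b.edgeCoords (x - b 0) = fun i => b.coord i.succ x := by
  rw [← LinearEquiv.eq_symm_apply, edgeCoords_symm_apply]
  have h1 := b.sum_coord_apply_eq_one x
  have h2 := b.linear_combination_coord_eq_self x
  rw [Fin.sum_univ_succ] at h1 h2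
  simp only [smul_sub, Finset.sum_sub_distrib, ← Finset.sum_smul]
  rw [← eq_sub_iff_add_eq'] at h1
  rw [h1]
  conv_lhs => rw [← h2]
  module

theorem AffineBasis.mem_convexHull_iff_edgeCoords (b : AffineBasis (Fin 4) ℝ (Fin 3 → ℝ))
    (x : Fin 3 → ℝ) :
    x ∈ convexHull ℝ (Set.range b) ↔ b.edgeCoords (x - b 0) ∈ dilatedStdSimplex 1 := by
  rw [b.convexHull_eq_nonneg_coord, edgeCoords_sub, dilatedStdSimplex, Set.mem_ofPred_eq,
    Set.mem_ofPred_eq, Fin.forall_fin_succ, and_comm]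
  have h1 := b.sum_coord_apply_eq_one x
  rw [Fin.sum_univ_succ] at h1
  refine and_congr Iff.rfl ?_
  rw [Nat.cast_one]
  constructor <;> intro h <;> linarith

theorem AffineBasis.mem_smul_convexHull_iff_edgeCoords (b : AffineBasis (Fin 4) ℝ (Fin 3 → ℝ))
    {n : ℕ} (hn : 0 < n) (x : Fin 3 → ℝ) :
    x ∈ (n : ℝ) • convexHull ℝ (Set.range b) ↔
      b.edgeCoords (x - (n : ℝ) • b 0) ∈ dilatedStdSimplex n := by
  have hn' : (n : ℝ) ≠ 0 := by exact_mod_cast hn.ne'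
  rw [Set.mem_smul_set_iff_inv_smul_mem₀ hn', mem_convexHull_iff_edgeCoords,
    ← inv_smul_mem_dilatedStdSimplex hn, ← map_smul, smul_sub, inv_smul_smul₀ hn']

/-- The vertex `n • b 0` is an integer point, so shifting the summation absorbs it. The substitution
`z ↦ -z` turns the count at `-u` into that of the reflected simplex at `u`. -/
theorem AffineBasis.translateCount_smul_convexHull (b : AffineBasis (Fin 4) ℝ (Fin 3 → ℝ))
    (hb : ∀ i, b i ∈ integerPoints 3) {n : ℕ} (hn : 0 < n) (u : Fin 3 → ℝ) :
    translateCount ((n : ℝ) • convexHull ℝ (Set.range b)) u +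
      translateCount ((n : ℝ) • convexHull ℝ (Set.range b)) (-u) =
    ∑' z : Fin 3 → ℤ, ((dilatedStdSimplex n).indicator 1 (b.edgeCoords (intVec z - u)) +
      (dilatedStdSimplex n).indicator 1 (-b.edgeCoords (intVec z - u))) := by
  obtain ⟨v, hv⟩ := mem_integerPoints_iff.1 (hb 0)
  have hv' : intVec (n • v) = (n : ℝ) • b 0 := by rw [map_nsmul, hv, Nat.cast_smul_eq_nsmul]
  have key : ∀ u, translateCount ((n : ℝ) • convexHull ℝ (Set.range b)) u =
      ∑' z : Fin 3 → ℤ, (dilatedStdSimplex n).indicator 1 (b.edgeCoords (intVec z - u)) := by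
    intro u
    rw [translateCount, ← tsum_indicator_intVec_add
      (fun x => ((n : ℝ) • convexHull ℝ (Set.range b)).indicator 1 (x - u)) (n • v)]
    refine tsum_congr fun z => ?_
    rw [hv']
    by_cases h : b.edgeCoords (intVec z - u) ∈ dilatedStdSimplex n
    · rw [Set.indicator_of_mem h, Set.indicator_of_mem]
      · rfl
      · rw [b.mem_smul_convexHull_iff_edgeCoords hn]
        convert h using 2
        abel
    · rw [Set.indicator_of_notMem h, Set.indicator_of_notMem]
      rw [b.mem_smul_convexHull_iff_edgeCoords hn]
      convert h using 3
      abel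
  rw [ENNReal.tsum_add, key, key]
  congr 1
  rw [← (Equiv.neg (Fin 3 → ℤ)).tsum_eq]
  refine tsum_congr fun z => congrArg _ ?_
  rw [← map_neg]
  congr 1
  simp only [Equiv.neg_apply, map_neg]
  abel

theorem AffineBasis.exists_translateCount_simplex (b : AffineBasis (Fin 4) ℝ (Fin 3 → ℝ))
    (hb : ∀ i, b i ∈ integerPoints 3) {n : ℕ} (hn : 0 < n) :
    ∃ c : ℝ≥0∞, ∀ᵐ u : Fin 3 → ℝ,
      translateCount ((n : ℝ) • convexHull ℝ (Set.range b)) u +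
        translateCount ((n : ℝ) • convexHull ℝ (Set.range b)) (-u) =
      n * (translateCount (convexHull ℝ (Set.range b)) u +
        translateCount (convexHull ℝ (Set.range b)) (-u)) + c := by
  choose v hv using fun i => mem_integerPoints_iff.1 (hb i)
  let φ : (Fin 3 → ℤ) →+ (Fin 3 → ℤ) :=
    { toFun := fun w => ∑ i, w i • (v i.succ - v 0)
      map_zero' := by simp
      map_add' := fun w w' => by simp [add_smul, Finset.sum_add_distrib] }
  have hφ : ∀ w, b.edgeCoords (intVec (φ w)) = intVec w := fun w => by
    rw [← LinearEquiv.eq_symm_apply, edgeCoords_symm_apply]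
    show intVec (∑ i, w i • (v i.succ - v 0)) = _
    rw [map_sum]
    refine Finset.sum_congr rfl fun i _ => ?_
    rw [map_zsmul, map_sub, hv, hv, intVec_apply, Int.cast_smul_eq_zsmul]
  have hinj : Function.Injective φ := fun w w' h => intVec_injective (by rw [← hφ, h, hφ])
  -- Each coset of the edge lattice contributes the same constant. With values in `ℝ≥0∞` the index
  -- need not be known to be finite here; `c ≠ ⊤` is deduced later from the finiteness of the
  -- counts.
  refine ⟨∑' _ : (Fin 3 → ℤ) ⧸ φ.range, ((2 * (n + 1).choose 3 : ℕ) : ℝ≥0∞), ?_⟩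
  filter_upwards [ae_avoidsFacetPlanes b.edgeCoords] with u hu
  have h1 := b.translateCount_smul_convexHull hb one_pos u
  rw [Nat.cast_one, one_smul] at h1
  rw [b.translateCount_smul_convexHull hb hn, h1, tsum_eq_tsum_cosets φ hinj,
    tsum_eq_tsum_cosets φ hinj, ← ENNReal.tsum_mul_left, ← ENNReal.tsum_add]
  refine tsum_congr fun q => ?_
  have hq : ∀ w, b.edgeCoords (intVec (q.out + φ w) - u) =
      fun i => b.edgeCoords (intVec q.out - u) i + w i := fun w => by
    rw [map_add, add_sub_right_comm, map_add, hφ]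
    rfl
  simp only [hq]
  exact tsum_dilatedStdSimplex_add_neg (hu _) n

/-! ### From simplices to integer polytopes. -/

/-- An exceptional null set is harmless: only the countably many maps `u ↦ z - u` occur, and each
pulls null sets back to null sets. -/
theorem ae_translateCount_eq_sum {d : ℕ} {C : Set (Fin d → ℝ)} {ι : Type*} {T : Finset ι}
    {D : ι → Set (Fin d → ℝ)}
    (h : ∀ᵐ x : Fin d → ℝ, C.indicator (1 : (Fin d → ℝ) → ℝ≥0∞) x =
      ∑ σ ∈ T, (D σ).indicator 1 x) :
    ∀ᵐ u : Fin d → ℝ, translateCount C u = ∑ σ ∈ T, translateCount (D σ) u := by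
  have : ∀ᵐ u : Fin d → ℝ, ∀ z : Fin d → ℤ,
      C.indicator (1 : (Fin d → ℝ) → ℝ≥0∞) (intVec z - u) =
        ∑ σ ∈ T, (D σ).indicator 1 (intVec z - u) := by
    rw [ae_all_iff]
    intro z
    exact (quasiMeasurePreserving_sub_left_of_right_invariant volume (intVec z)).ae h
  filter_upwards [this] with u hu
  simp only [translateCount, hu]
  exact Summable.tsum_finsetSum fun _ _ => ENNReal.summable

theorem indicator_smul_set {E : Type*} [AddCommGroup E] [Module ℝ E] {r : ℝ} (hr : r ≠ 0)
    (C : Set E) (x : E) :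
    (r • C).indicator (1 : E → ℝ≥0∞) x = C.indicator 1 (r⁻¹ • x) := by
  by_cases h : r⁻¹ • x ∈ C
  · rw [Set.indicator_of_mem h, Set.indicator_of_mem ((Set.mem_smul_set_iff_inv_smul_mem₀ hr _ _).2 h)]
    rfl
  · rw [Set.indicator_of_notMem h,
      Set.indicator_of_notMem (mt (Set.mem_smul_set_iff_inv_smul_mem₀ hr _ _).1 h)]

theorem IsSimplexVertexSet.exists_translateCount {σ : Finset (Fin 3 → ℝ)}
    (h : IsSimplexVertexSet σ) (hσ : (σ : Set (Fin 3 → ℝ)) ⊆ integerPoints 3) {n : ℕ}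
    (hn : 0 < n) :
    ∃ c : ℝ≥0∞, ∀ᵐ u : Fin 3 → ℝ,
      translateCount ((n : ℝ) • convexHull ℝ (σ : Set (Fin 3 → ℝ))) u +
        translateCount ((n : ℝ) • convexHull ℝ (σ : Set (Fin 3 → ℝ))) (-u) =
      n * (translateCount (convexHull ℝ (σ : Set (Fin 3 → ℝ))) u +
        translateCount (convexHull ℝ (σ : Set (Fin 3 → ℝ))) (-u)) + c := by
  have hcard : σ.card = 4 := by simpa using h.card_eq
  let b : AffineBasis (Fin 4) ℝ (Fin 3 → ℝ) := h.basis.reindex (σ.equivFinOfCardEq hcard)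
  have hb : ∀ i, b i = ((σ.equivFinOfCardEq hcard).symm i : Fin 3 → ℝ) := fun i => by
    rw [AffineBasis.reindex_apply]
    rfl
  have hrange : Set.range b = σ := by
    ext x
    constructor
    · rintro ⟨i, rfl⟩
      rw [hb]
      exact ((σ.equivFinOfCardEq hcard).symm i).2
    · intro hx
      exact ⟨σ.equivFinOfCardEq hcard ⟨x, hx⟩, by rw [hb, Equiv.symm_apply_apply]⟩
  rw [← hrange]
  exact b.exists_translateCount_simplex
    (fun i => hσ (by rw [← hrange]; exact Set.mem_range_self i)) hn

/-- Up to a constant, the number of integer points in the translates of a dilated integer polytope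
and of its reflection grows linearly with the dilation factor. -/
theorem IsIntegerPolytope.exists_translateCount {P : Set (Fin 3 → ℝ)} (hP : IsIntegerPolytope P)
    {n : ℕ} (hn : 0 < n) :
    ∃ c : ℝ≥0∞, ∀ᵐ u : Fin 3 → ℝ,
      translateCount ((n : ℝ) • P) u + translateCount ((n : ℝ) • P) (-u) =
      n * (translateCount P u + translateCount P (-u)) + c := by
  obtain ⟨S, hfin, hS, rfl⟩ := hP
  lift S to Finset (Fin 3 → ℝ) using hfin
  obtain ⟨T, hT, hind⟩ := exists_triangulation (volume : Measure (Fin 3 → ℝ)) S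
  have hn' : (n : ℝ) ≠ 0 := by exact_mod_cast hn.ne'
  have h1 := ae_translateCount_eq_sum hind
  have h2 : ∀ᵐ u : Fin 3 → ℝ, translateCount ((n : ℝ) • convexHull ℝ (S : Set (Fin 3 → ℝ))) u =
      ∑ σ ∈ T, translateCount ((n : ℝ) • convexHull ℝ (σ : Set (Fin 3 → ℝ))) u := by
    refine ae_translateCount_eq_sum ?_
    simp only [indicator_smul_set hn']
    exact (Measure.quasiMeasurePreserving_smul volume (inv_ne_zero hn')).ae hind
  have hneg := quasiMeasurePreserving_neg (volume : Measure (Fin 3 → ℝ))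
  have hex : ∀ σ : Finset (Fin 3 → ℝ), ∃ c : ℝ≥0∞, σ ∈ T → ∀ᵐ u : Fin 3 → ℝ,
      translateCount ((n : ℝ) • convexHull ℝ (σ : Set (Fin 3 → ℝ))) u +
        translateCount ((n : ℝ) • convexHull ℝ (σ : Set (Fin 3 → ℝ))) (-u) =
      n * (translateCount (convexHull ℝ (σ : Set (Fin 3 → ℝ))) u +
        translateCount (convexHull ℝ (σ : Set (Fin 3 → ℝ))) (-u)) + c := fun σ => by
    by_cases hσ : σ ∈ T
    · obtain ⟨c, hc⟩ := (hT σ hσ).2.exists_translateCount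
        (fun x hx => hS ((hT σ hσ).1 hx)) hn
      exact ⟨c, fun _ => hc⟩
    · exact ⟨0, fun h => absurd h hσ⟩
  choose c hc using hex
  refine ⟨∑ σ ∈ T, c σ, ?_⟩
  have h3 := (Finset.eventually_all T).2 hc
  filter_upwards [h1, h2, hneg.ae h1, hneg.ae h2, h3] with u e1 e2 e3 e4 e5
  rw [e1, e2, e3, e4, ← Finset.sum_add_distrib, ← Finset.sum_add_distrib, Finset.mul_sum,
    ← Finset.sum_add_distrib]
  exact Finset.sum_congr rfl e5

/-! ### Central symmetry. -/

theorem translateCount_neg_of_symm {d : ℕ} {C : Set (Fin d → ℝ)} {v : Fin d → ℤ}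
    (hC : ∀ x, intVec v - x ∈ C ↔ x ∈ C) (u : Fin d → ℝ) :
    translateCount C (-u) = translateCount C u := by
  rw [translateCount_neg, translateCount,
    ← tsum_indicator_intVec_add (fun x => C.indicator 1 (x - u)) v]
  refine tsum_congr fun z => ?_
  have e : intVec v - -(intVec z - u) = intVec z + intVec v - u := by abel
  by_cases h : -(intVec z - u) ∈ C
  · rw [Set.indicator_of_mem h, Set.indicator_of_mem (by rwa [← hC, e] at h)]
    rfl
  · rw [Set.indicator_of_notMem h, Set.indicator_of_notMem (by rwa [← hC, e] at h)]

/-- The doubled centre of a nonempty centrally symmetric integer polytope is an integer point. -/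
theorem IsIntegerPolytope.exists_intVec_reflection {d : ℕ} {P : Set (Fin d → ℝ)}
    (hP : IsIntegerPolytope P) (hsymm : IsCentrallySymmetric P) :
    ∃ v : Fin d → ℤ, ∀ x, intVec v - x ∈ P ↔ x ∈ P := by
  obtain ⟨S, hfin, hS, rfl⟩ := hP
  obtain ⟨c, hc⟩ := hsymm
  rcases (convexHull ℝ S).eq_empty_or_nonempty with he | hne
  · exact ⟨0, fun x => by simp [he]⟩
  have hrefl : ∀ x ∈ convexHull ℝ S, (2 : ℝ) • c - x ∈ convexHull ℝ S := fun x hx =>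
    hc.subset (Set.mem_image_of_mem _ hx)
  -- The reflection permutes the extreme points, all of which lie in `S`. So `p` and `2c - p` are
  -- both integer, and so is their sum `2c`.
  obtain ⟨p, hp⟩ := (hfin.isCompact_convexHull (𝕜 := ℝ)).extremePoints_nonempty hne
  have hp' : (2 : ℝ) • c - p ∈ (convexHull ℝ S).extremePoints ℝ := by
    rw [mem_extremePoints_iff_left] at hp ⊢
    refine ⟨hrefl p hp.1, fun x hx y hy hxy => ?_⟩
    obtain ⟨a, b, ha, hb, hab, h⟩ := hxy
    have := hp.2 _ (hrefl x hx) _ (hrefl y hy) ⟨a, b, ha, hb, hab, by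
      rw [smul_sub, smul_sub, sub_add_sub_comm, h, ← add_smul, hab, one_smul]
      abel⟩
    rw [← this]
    abel
  obtain ⟨v, hv⟩ := mem_integerPoints_iff.1 (hS (extremePoints_convexHull_subset hp))
  obtain ⟨v', hv'⟩ := mem_integerPoints_iff.1 (hS (extremePoints_convexHull_subset hp'))
  have h2c : intVec (v + v') = (2 : ℝ) • c := by
    rw [map_add, hv, hv']
    abel
  refine ⟨v + v', fun x => ?_⟩
  rw [h2c]
  exact ⟨fun h => by simpa using hrefl _ h, hrefl x⟩

/-! ### Boundedness, measurability and the probabilistic conclusion. -/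

theorem finite_preimage_intVec {d : ℕ} {B : Set (Fin d → ℝ)} (hB : Bornology.IsBounded B) :
    (intVec ⁻¹' B).Finite := by
  obtain ⟨R, hR⟩ := hB.exists_norm_le
  refine (Set.finite_Icc (fun _ : Fin d => -⌈R⌉) fun _ => ⌈R⌉).subset fun z hz => ?_
  have hi : ∀ i, |(z i : ℝ)| ≤ R := fun i => (norm_le_pi_norm (intVec z) i).trans (hR _ hz)
  constructor
  · intro i
    have : (-⌈R⌉ : ℝ) ≤ z i := by linarith [(abs_le.1 (hi i)).1, Int.le_ceil R]
    exact_mod_cast this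
  · intro i
    have : (z i : ℝ) ≤ ⌈R⌉ := by linarith [(abs_le.1 (hi i)).2, Int.le_ceil R]
    exact_mod_cast this

theorem exists_translateCount_le {d : ℕ} {C K : Set (Fin d → ℝ)} (hC : Bornology.IsBounded C)
    (hK : Bornology.IsBounded K) : ∃ M : ℝ≥0∞, M ≠ ⊤ ∧ ∀ u ∈ K, translateCount C u ≤ M := by
  refine ⟨(intVec ⁻¹' (C + K)).encard, ?_, fun u hu => ?_⟩
  · simpa [Set.encard_ne_top_iff] using finite_preimage_intVec (hC.add hK)
  · rw [translateCount, tsum_indicator_comp (fun z : Fin d → ℤ => intVec z - u)]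
    gcongr
    exact fun z hz => ⟨_, hz, u, hu, sub_add_cancel _ _⟩

theorem measurable_latticeCount {d : ℕ} {C : Set (Fin d → ℝ)} (hC : MeasurableSet C) :
    Measurable (latticeCount C) := by
  have : latticeCount C = fun u => (translateCount C u).toReal :=
    funext fun u => (toReal_translateCount C u).symm
  rw [this]
  refine (Measurable.tsum fun z => ?_).ennreal_toReal
  exact (measurable_one.indicator hC).comp (measurable_const.sub measurable_id)

theorem exists_latticeCount_le {d : ℕ} {C K : Set (Fin d → ℝ)} (hC : Bornology.IsBounded C)
    (hK : Bornology.IsBounded K) : ∃ M : ℝ, ∀ u ∈ K, ‖latticeCount C u‖ ≤ M := by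
  obtain ⟨M, hM, h⟩ := exists_translateCount_le hC hK
  refine ⟨M.toReal, fun u hu => ?_⟩
  rw [← toReal_translateCount, Real.norm_of_nonneg ENNReal.toReal_nonneg]
  exact ENNReal.toReal_mono hM (h u hu)

theorem IsIntegerPolytope.isCompact {d : ℕ} {P : Set (Fin d → ℝ)} (hP : IsIntegerPolytope P) :
    IsCompact P := by
  obtain ⟨S, hfin, -, rfl⟩ := hP
  exact hfin.isCompact_convexHull (𝕜 := ℝ)

/-- For a centrally symmetric integer polytope, the number of integer points in a translate of the
`n`-th dilate is, up to an additive constant, `n` times the number for the polytope itself. -/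
theorem IsIntegerPolytope.exists_latticeCount_smul {P : Set (Fin 3 → ℝ)} (hP : IsIntegerPolytope P)
    (hsymm : IsCentrallySymmetric P) {n : ℕ} (hn : 0 < n) :
    ∃ c : ℝ, ∀ᵐ u : Fin 3 → ℝ, latticeCount ((n : ℝ) • P) u = n * latticeCount P u + c := by
  obtain ⟨c, hc⟩ := hP.exists_translateCount hn
  obtain ⟨v, hv⟩ := hP.exists_intVec_reflection hsymm
  have hn' : (n : ℝ) ≠ 0 := by exact_mod_cast hn.ne'
  have hv' : ∀ x, intVec (n • v) - x ∈ (n : ℝ) • P ↔ x ∈ (n : ℝ) • P := fun x => by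
    rw [Set.mem_smul_set_iff_inv_smul_mem₀ hn', Set.mem_smul_set_iff_inv_smul_mem₀ hn', ← hv,
      map_nsmul, ← Nat.cast_smul_eq_nsmul ℝ, smul_sub, inv_smul_smul₀ hn', sub_sub_cancel]
  have htop : ∀ {C : Set (Fin 3 → ℝ)}, IsCompact C → ∀ u, translateCount C u ≠ ⊤ := by
    intro C hC u
    obtain ⟨M, hM, h⟩ := exists_translateCount_le hC.isBounded (K := {u}) Bornology.isBounded_singleton
    exact ne_top_of_le_ne_top hM (h u rfl)
  have hPn : IsCompact ((n : ℝ) • P) := hP.isCompact.smul _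
  -- A single `u` satisfying the identity suffices, since its left side is finite.
  have hctop : c ≠ ⊤ := by
    obtain ⟨u, hu⟩ := hc.exists
    intro h
    rw [h, add_top] at hu
    exact ENNReal.add_ne_top.2 ⟨htop hPn u, htop hPn (-u)⟩ hu
  -- By symmetry the counts at `u` and `-u` agree, so the identity is twice the desired one.
  refine ⟨c.toReal / 2, ?_⟩
  filter_upwards [hc] with u hu
  rw [translateCount_neg_of_symm hv, translateCount_neg_of_symm hv'] at hu
  have := congrArg ENNReal.toReal hu
  have hP1 := htop hP.isCompact u
  rw [ENNReal.toReal_add (htop hPn u) (htop hPn u), ENNReal.toReal_add (by finiteness) hctop,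
    ENNReal.toReal_mul, ENNReal.toReal_add hP1 hP1, toReal_translateCount, toReal_translateCount,
    ENNReal.toReal_natCast] at this
  linarith

theorem memLp_shiftCount {Ω : Type*} [MeasurableSpace Ω] {μ : Measure Ω} [IsProbabilityMeasure μ]
    {d : ℕ} {U : Ω → Fin d → ℝ} (hU : AEMeasurable U μ) {K : Set (Fin d → ℝ)}
    (hK : Bornology.IsBounded K) (hUK : ∀ᵐ ω ∂μ, U ω ∈ K) {C : Set (Fin d → ℝ)}
    (hC : IsCompact C) (p : ℝ≥0∞) : MemLp (shiftCount U C) p μ := by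
  obtain ⟨M, hM⟩ := exists_latticeCount_le hC.isBounded hK
  refine MemLp.of_bound
    ((measurable_latticeCount hC.measurableSet).comp_aemeasurable hU).aestronglyMeasurable M ?_
  filter_upwards [hUK] with ω hω using hM _ hω

theorem mainTheorem6 {Ω : Type*} [MeasurableSpace Ω] (μ : Measure Ω) [IsProbabilityMeasure μ]
    (U : Ω → Fin 3 → ℝ) (hU : pdf.IsUniform U (Set.Icc (0 : Fin 3 → ℝ) 1) μ volume)
    (P : Set (Fin 3 → ℝ)) (hP : IsIntegerPolytope P) (hsymm : IsCentrallySymmetric P)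
    (n : ℕ) (hn : 0 < n) :
    EqUpToConst μ (shiftCount U ((n : ℝ) • P)) (fun ω => (n : ℝ) * shiftCount U P ω) ∧
      MemLp (shiftCount U P) 2 μ ∧
      MemLp (shiftCount U ((n : ℝ) • P)) 2 μ ∧
      Var[shiftCount U ((n : ℝ) • P); μ] = (n : ℝ) ^ 2 * Var[shiftCount U P; μ] := by
  have hvol : volume (Set.Icc (0 : Fin 3 → ℝ) 1) = 1 := by simp [Real.volume_Icc_pi]
  have hUm : AEMeasurable U μ := hU.aemeasurable (by simp [hvol]) (by simp [hvol])
  have hUK : ∀ᵐ ω ∂μ, U ω ∈ Set.Icc (0 : Fin 3 → ℝ) 1 := by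
    refine ae_of_ae_map hUm ?_
    rw [hU]
    exact ae_cond_mem measurableSet_Icc
  have hK : Bornology.IsBounded (Set.Icc (0 : Fin 3 → ℝ) 1) := isCompact_Icc.isBounded
  have hX : MemLp (shiftCount U P) 2 μ := memLp_shiftCount hUm hK hUK hP.isCompact 2
  have hXn : MemLp (shiftCount U ((n : ℝ) • P)) 2 μ :=
    memLp_shiftCount hUm hK hUK (hP.isCompact.smul _) 2
  have hXi := hX.integrable one_le_two
  obtain ⟨c, hc⟩ := hP.exists_latticeCount_smul hsymm hn
  have hae : shiftCount U ((n : ℝ) • P) =ᵐ[μ] fun ω => n * shiftCount U P ω + c :=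
    ae_of_ae_map hUm (hU.absolutelyContinuous.ae_le hc)
  refine ⟨⟨hXn.integrable one_le_two, hXi.const_mul _, ?_⟩, hX, hXn, ?_⟩
  · have hint : ∫ ω, shiftCount U ((n : ℝ) • P) ω ∂μ = ∫ ω, n * shiftCount U P ω ∂μ + c := by
      rw [integral_congr_ae hae, integral_add (hXi.const_mul _) (integrable_const c)]
      simp
    filter_upwards [hae] with ω hω
    rw [hω, hint]
    ring
  · rw [variance_congr hae,
      variance_add_const (hXi.const_mul (n : ℝ)).aestronglyMeasurable, variance_const_mul]
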